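/- Let $d \ge 2$ and let $\mathbf n = (n_1,\dots,n_d) \in \mathbb Z_{>0}^d$ be a velocity vector, that is, its entries are positive, pairwise distinct and relatively prime ($\gcd(n_1,\dots,n_d)=1$). Let $$Z_{\mathbf n} = \mathrm{Zon}(\mathbf e_1,\dots,\mathbf e_d,\mathbf n) = [\mathbf 0,\mathbf e_1] + \dots + [\mathbf 0,\mathbf e_d] + [\mathbf 0,\mathbf n] \subseteq \mathbb R^d$$ be the associated lonely runner zonotope (a Minkowski sum of segments, $\mathbf e_i$ being the standard unit vectors). Then $$\mathrm{vol}(Z_{\mathbf n}) = 1 + n_1 + \dots + n_d,$$ $$\#\bigl(\mathrm{int}(Z_{\mathbf n}) \cap \mathbb Z^d\bigr) = \sum_{\substack{\ell \in \mathbb N,\ \ell \mid n_j \\ \text{for some } j \in \{1,\dots,d\}}} \varphi(\ell),$$ $$\#\bigl(Z_{\mathbf n} \cap \mathbb Z^d\bigr) = 2^d + \sum_{\substack{\ell \in \mathbb N,\ \ell \mid n_j \\ \text{for some } j \in \{1,\dots,d\}}} \varphi(\ell)\,\bigl(2^{\# J_\ell} - 1\bigr),$$ where $\varphi$ is Euler's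 totient function and $J_\ell$ is the inclusion-wise maximal subset $J \subseteq \{1,\dots,d\}$ with $\ell \mid n_j$ for all $j \in J$, i.e. $J_\ell = \{ j : \ell \mid n_j \}$. -/

import Mathlib

open scoped Pointwise ENNReal

/-- A velocity vector: at least two entries, all of them positive integers, pairwise distinct, and
(jointly) relatively prime. -/
structure IsVelocityVector {d : ℕ} (n : Fin d → ℕ) : Prop where
  two_le : 2 ≤ d
  pos : ∀ i, 0 < n i
  distinct : Function.Injective n
  coprime : Finset.univ.gcd n = 1

/-- The zonotope generated by `g 0, …, g (m - 1)` in `ℝ^d`: the Minkowski sum of the segments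
`[0, g j]`. -/
def Zon {d m : ℕ} (g : Fin m → (Fin d → ℝ)) : Set (Fin d → ℝ) :=
  ∑ j, segment ℝ 0 (g j)

/-- The generators `e_1, …, e_d, n` of the lonely runner zonotope, in this order. -/
def lonelyRunnerGenerators {d : ℕ} (n : Fin d → ℕ) : Fin (d + 1) → (Fin d → ℝ) :=
  Fin.snoc (α := fun _ => Fin d → ℝ) (fun i => Pi.single i 1) (fun i => (n i : ℝ))

/-- The lonely runner zonotope `Zon(e_1, …, e_d, n)`. -/
def lonelyRunnerZonotope {d : ℕ} (n : Fin d → ℕ) : Set (Fin d → ℝ) :=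
  Zon (lonelyRunnerGenerators n)

/-- The integer lattice `ℤ^d` inside `ℝ^d`. -/
def integerLattice (d : ℕ) : Set (Fin d → ℝ) :=
  Set.range fun (z : Fin d → ℤ) (i : Fin d) => (z i : ℝ)

/-- The natural numbers dividing at least one entry of `n`, for `n` with positive entries. -/
def entryDivisors {d : ℕ} (n : Fin d → ℕ) : Finset ℕ :=
  Finset.univ.biUnion fun j => (n j).divisors

/-- The largest set of indices `J` such that `ℓ` divides `n j` for all `j ∈ J`. -/
def divisibleIndices {d : ℕ} (n : Fin d → ℕ) (ℓ : ℕ) : Finset (Fin d) :=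
  {j | ℓ ∣ n j}

/-! The zonotope is swept out by the unit cube moving along `t • n` for `t ∈ [0, 1]`; each count
sorts points by an extreme time at which the moving cube contains them.

Volume: a point outside the initial cube is first met at some `t > 0`, on a facet `x i = t * n i +
1`. Choosing the least such `i` partitions the rest of the zonotope into sheared half-open boxes of
volume `n i` (`lonelyRunnerZonotope_eq_union`, `volume_sweptPart`).

Lattice points: if the motion is continued beyond `t = 1`, the cube leaves `z` at `s = min (z i / n
i)`, a rational whose denominator `ℓ` divides some `n i`. Then `z` is the ceiling of `s • n`, raised
by one on a proper subset of `J_ℓ` (`eq_raisedCeil`), and `z` determines both `s` and the subset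
(`raisedCeil_inj`). There are `φ(ℓ)` such times in `(0, 1]`, each with `2 ^ #J_ℓ - 1` subsets.
Interior points are those with empty subset. The times `s = 0` and `s > 1` give `2 ^ d - 1` cube
vertices and the point `n + 1`. -/

theorem mem_lonelyRunnerZonotope {d : ℕ} (n : Fin d → ℕ) (x : Fin d → ℝ) :
    x ∈ lonelyRunnerZonotope n ↔
      ∃ t ∈ Set.Icc (0 : ℝ) 1, ∀ i, t * n i ≤ x i ∧ x i ≤ t * n i + 1 := by
  have hseg : ∀ y z : Fin d → ℝ, z ∈ segment ℝ 0 y ↔ ∃ t ∈ Set.Icc (0 : ℝ) 1, t • y = z := by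
    intro y z
    simp [segment_eq_image']
  simp only [lonelyRunnerZonotope, Zon, Set.mem_fintype_sum, hseg, lonelyRunnerGenerators]
  constructor
  · rintro ⟨g, hg, rfl⟩
    choose s hs hsg using hg
    refine ⟨s (Fin.last d), hs _, fun i => ?_⟩
    have : (∑ j, g j) i = s i.castSucc + s (Fin.last d) * n i := by
      simp [← hsg, Fin.sum_univ_castSucc, Finset.sum_apply, Pi.single_apply]
    rw [this]
    have := hs i.castSucc
    constructor <;> linarith [this.1, this.2]
  · rintro ⟨t, ht, hx⟩
    refine ⟨Fin.snoc (α := fun _ => Fin d → ℝ) (fun i => (x i - t * n i) • Pi.single i 1)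
      (t • fun i => (n i : ℝ)), fun j => ?_, ?_⟩
    · refine Fin.lastCases ?_ (fun i => ?_) j
      · exact ⟨t, ht, by simp⟩
      · exact ⟨x i - t * n i, ⟨by linarith [hx i], by linarith [hx i]⟩, by simp⟩
    · ext i
      simp [Fin.sum_univ_castSucc, Finset.sum_apply, Pi.single_apply]

/-- The union `U` of the open cubes is open and convex, and the zonotope lies between `U` and its
closure; a nonempty open convex set is the interior of its closure. -/
theorem mem_interior_lonelyRunnerZonotope {d : ℕ} (n : Fin d → ℕ) (x : Fin d → ℝ) :
    x ∈ interior (lonelyRunnerZonotope n) ↔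
      ∃ t ∈ Set.Icc (0 : ℝ) 1, ∀ i, t * n i < x i ∧ x i < t * n i + 1 := by
  set U : Set (Fin d → ℝ) :=
    {x | ∃ t ∈ Set.Icc (0 : ℝ) 1, ∀ i, t * n i < x i ∧ x i < t * n i + 1} with hU
  have hopen : IsOpen U := by
    have : U = ⋃ t ∈ Set.Icc (0 : ℝ) 1,
        Set.univ.pi fun i => Set.Ioo (t * n i) (t * n i + 1) := by
      ext x
      simp [hU, Set.mem_pi]
    rw [this]
    exact isOpen_biUnion fun t _ => isOpen_set_pi Set.finite_univ fun i _ => isOpen_Ioo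
  have hconv : Convex ℝ U := by
    rintro x ⟨s, hs, hx⟩ y ⟨t, ht, hy⟩ a b ha hb hab
    refine ⟨a * s + b * t, convex_Icc (0 : ℝ) 1 hs ht ha hb hab, fun i => ?_⟩
    have h := convex_Ioo (0 : ℝ) 1 (x := x i - s * n i) (y := y i - t * n i)
      ⟨by linarith [hx i], by linarith [hx i]⟩ ⟨by linarith [hy i], by linarith [hy i]⟩ ha hb hab
    simp only [smul_eq_mul, Set.mem_Ioo, Pi.add_apply, Pi.smul_apply] at h ⊢
    constructor <;> linarith [h.1, h.2]
  have hsub : U ⊆ lonelyRunnerZonotope n := fun x ⟨t, ht, hx⟩ =>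
    (mem_lonelyRunnerZonotope n x).2 ⟨t, ht, fun i => ⟨(hx i).1.le, (hx i).2.le⟩⟩
  have hcl : lonelyRunnerZonotope n ⊆ closure U := by
    intro x hx
    obtain ⟨t, ht, hx⟩ := (mem_lonelyRunnerZonotope n x).1 hx
    have hxc : x ∈ closure (Set.univ.pi fun i => Set.Ioo (t * n i) (t * n i + 1)) := by
      rw [closure_pi_set]
      intro i _
      change x i ∈ closure (Set.Ioo (t * n i : ℝ) (t * n i + 1))
      rw [closure_Ioo (lt_add_one _).ne]
      exact hx i
    have hUt : (Set.univ.pi fun i => Set.Ioo (t * n i) (t * n i + 1)) ⊆ U :=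
      fun y hy => ⟨t, ht, fun i => hy i trivial⟩
    exact closure_mono hUt hxc
  have hne : (interior U).Nonempty := by
    rw [hopen.interior_eq]
    exact ⟨fun _ => 1 / 2, 0, by simp, fun i => by norm_num⟩
  have : interior (lonelyRunnerZonotope n) = U := by
    apply subset_antisymm
    · refine (interior_mono hcl).trans ?_
      rw [hconv.interior_closure_eq_interior_of_nonempty_interior hne]
      exact interior_subset
    · exact interior_maximal hsub hopen
  rw [this]
  rfl

/-! ### Volume -/

theorem volume_preimage_column_shear {d : ℕ} (i : Fin d) (v : Fin d → ℝ) (hv : 0 < v i)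
    (s : Set (Fin d → ℝ)) :
    MeasureTheory.volume ((fun x : Fin d → ℝ =>
      Matrix.toLin' ((1 : Matrix (Fin d) (Fin d) ℝ).updateCol i v) (x - Pi.single i 1)) ⁻¹' s) =
      ENNReal.ofReal (v i)⁻¹ * MeasureTheory.volume s := by
  set f := Matrix.toLin' ((1 : Matrix (Fin d) (Fin d) ℝ).updateCol i v) with hf
  have hdet : LinearMap.det f = v i := by
    rw [hf, LinearMap.det_toLin', ← Matrix.cramer_apply, Matrix.cramer_one]
    rfl
  have h1 : (fun x : Fin d → ℝ => f (x - Pi.single i 1)) ⁻¹' s =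
      (fun x => x - Pi.single i 1) ⁻¹' (f ⁻¹' s) := rfl
  have h2 := MeasureTheory.Measure.addHaar_preimage_linearMap MeasureTheory.volume
    (f := f) (by rw [hdet]; exact hv.ne') s
  simp only [sub_eq_add_neg] at h1 ⊢
  rw [h1, MeasureTheory.measure_preimage_add_right, h2, hdet, abs_of_pos (inv_pos.2 hv)]

theorem toLin'_updateCol_one_apply {d : ℕ} (i j : Fin d) (v x : Fin d → ℝ) :
    Matrix.toLin' ((1 : Matrix (Fin d) (Fin d) ℝ).updateCol i v) x j =
      if j = i then v i * x i else x j + v j * x i := by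
  rw [Matrix.toLin'_apply, Matrix.mulVec, dotProduct, ← Finset.add_sum_erase _ _ (Finset.mem_univ i)]
  have : ∀ k ∈ Finset.univ.erase i, (1 : Matrix (Fin d) (Fin d) ℝ).updateCol i v j k * x k =
      if j = k then x k else 0 := by
    intro k hk
    rw [Matrix.updateCol_ne (Finset.ne_of_mem_erase hk), Matrix.one_apply]
    split_ifs <;> simp
  rw [Finset.sum_congr rfl this, Finset.sum_ite_eq]
  by_cases h : j = i
  · subst h; simp
  · simp [h, add_comm]

/-- The half-open box whose image under a shear is the part of the zonotope swept out by the
facet `x i = 1` of the unit cube. -/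
def sweptBox {d : ℕ} (i : Fin d) : Set (Fin d → ℝ) :=
  Set.univ.pi fun j => if j = i then Set.Ioc 0 1 else if j < i then Set.Ico 0 1 else Set.Icc 0 1

/-- The part of the lonely runner zonotope swept out by the facet `x i = 1` of the unit cube. -/
def sweptPart {d : ℕ} (n : Fin d → ℕ) (i : Fin d) : Set (Fin d → ℝ) :=
  -- This matrix sends `n` to `e_i` and fixes the other `e_j`, so coordinate `i` of the image is the
  -- time `t` and coordinate `j` is `x j - t * n j`.
  (fun x : Fin d → ℝ => Matrix.toLin' ((1 : Matrix (Fin d) (Fin d) ℝ).updateCol i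
    (fun j => if j = i then (n i : ℝ)⁻¹ else -(n j / n i : ℝ))) (x - Pi.single i 1)) ⁻¹' sweptBox i

theorem measurableSet_sweptBox {d : ℕ} (i : Fin d) : MeasurableSet (sweptBox i) := by
  refine MeasurableSet.univ_pi fun j => ?_
  split_ifs <;> measurability

theorem volume_sweptBox {d : ℕ} (i : Fin d) : MeasureTheory.volume (sweptBox i) = 1 := by
  rw [sweptBox, MeasureTheory.volume_pi_pi]
  refine Finset.prod_eq_one fun j _ => ?_
  split_ifs <;> simp

theorem measurableSet_sweptPart {d : ℕ} (n : Fin d → ℕ) (i : Fin d) :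
    MeasurableSet (sweptPart n i) := by
  refine (measurableSet_sweptBox i).preimage (Continuous.measurable ?_)
  exact (LinearMap.continuous_of_finiteDimensional _).comp (continuous_id.sub continuous_const)

theorem volume_sweptPart {d : ℕ} {n : Fin d → ℕ} (hn : ∀ i, 0 < n i) (i : Fin d) :
    MeasureTheory.volume (sweptPart n i) = n i := by
  have := hn i
  rw [sweptPart, volume_preimage_column_shear _ _ (by simp [this]), volume_sweptBox]
  simp

/-- Here `t` is the first time the moving cube meets `x`, and `i` the least index of a facet on
which this happens; hence `x` determines both. -/
theorem mem_sweptPart {d : ℕ} {n : Fin d → ℕ} (hn : ∀ i, 0 < n i) (i : Fin d) (x : Fin d → ℝ) :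
    x ∈ sweptPart n i ↔ ∃ t ∈ Set.Ioc (0 : ℝ) 1, x i = t * n i + 1 ∧
      (∀ j, t * n j ≤ x j ∧ x j ≤ t * n j + 1) ∧ ∀ j < i, x j < t * n j + 1 := by
  have hi : (0 : ℝ) < n i := by exact_mod_cast hn i
  simp only [sweptPart, sweptBox, Set.mem_preimage, Set.mem_univ_pi, toLin'_updateCol_one_apply]
  constructor
  · intro h
    have h0 := h i
    simp only [if_true, Pi.sub_apply, Pi.single_eq_same] at h0
    have hxi : x i = (n i : ℝ)⁻¹ * (x i - 1) * n i + 1 := by field_simp; ring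
    have key : ∀ j, j ≠ i → (x - Pi.single i 1 : Fin d → ℝ) j +
        -(n j / n i : ℝ) * (x - Pi.single i 1 : Fin d → ℝ) i =
        x j - (n i : ℝ)⁻¹ * (x i - 1) * n j := by
      intro j hj
      simp [hj]
      field_simp
      ring
    refine ⟨_, h0, hxi, fun j => ?_, fun j hj => ?_⟩
    · by_cases hj : j = i
      · subst hj
        constructor <;> linarith
      · have := h j
        simp only [if_neg hj, key j hj] at this
        split_ifs at this <;> exact ⟨by linarith [this.1], by linarith [this.2]⟩
    · have := h j
      simp only [if_neg hj.ne, key j hj.ne, if_pos hj] at this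
      linarith [this.2]
  · rintro ⟨t, ht, hxi, hx, hlt⟩ j
    by_cases hj : j = i
    · subst hj
      simpa [hxi, mul_comm, hi.ne'] using ht
    · have key : (x - Pi.single i 1 : Fin d → ℝ) j +
        -(n j / n i : ℝ) * (x - Pi.single i 1 : Fin d → ℝ) i =
          x j - t * n j := by
        simp [hj, hxi]
        field_simp
        ring
      simp only [if_neg hj, key]
      split_ifs with hji
      · exact ⟨by linarith [hx j], by linarith [hlt j hji]⟩
      · exact ⟨by linarith [hx j], by linarith [hx j]⟩

theorem eq_of_isGreatest_sweep {d : ℕ} {n : Fin d → ℕ} (hn : ∀ i, 0 < n i) {x : Fin d → ℝ}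
    {s t : ℝ} {i j : Fin d} (hs : x i = s * n i + 1) (ht : x j = t * n j + 1)
    (hs' : ∀ k, x k ≤ s * n k + 1) (ht' : ∀ k, x k ≤ t * n k + 1) : s = t := by
  have hi : (0 : ℝ) < n i := by exact_mod_cast hn i
  have hj : (0 : ℝ) < n j := by exact_mod_cast hn j
  apply le_antisymm
  · exact le_of_mul_le_mul_right (by linarith [ht' i]) hi
  · exact le_of_mul_le_mul_right (by linarith [hs' j]) hj

theorem pairwise_disjoint_sweptPart {d : ℕ} {n : Fin d → ℕ} (hn : ∀ i, 0 < n i) :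
    Pairwise (Function.onFun Disjoint (sweptPart n)) := by
  intro i j hij
  refine Set.disjoint_left.2 fun x hi hj => ?_
  obtain ⟨s, hs, hxi, hs1, hs2⟩ := (mem_sweptPart hn i x).1 hi
  obtain ⟨t, ht, hxj, ht1, ht2⟩ := (mem_sweptPart hn j x).1 hj
  obtain rfl := eq_of_isGreatest_sweep hn hxi hxj (fun k => (hs1 k).2) (fun k => (ht1 k).2)
  rcases lt_or_gt_of_ne hij with h | h
  · exact (ht2 i h).ne hxi
  · exact (hs2 j h).ne hxj

theorem disjoint_Icc_iUnion_sweptPart {d : ℕ} {n : Fin d → ℕ} (hn : ∀ i, 0 < n i) :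
    Disjoint (Set.Icc (0 : Fin d → ℝ) 1) (⋃ i, sweptPart n i) := by
  refine Set.disjoint_left.2 fun x hx hx' => ?_
  obtain ⟨i, hi⟩ := Set.mem_iUnion.1 hx'
  obtain ⟨t, ht, hxi, -⟩ := (mem_sweptPart hn i x).1 hi
  have hi : (0 : ℝ) < n i := by exact_mod_cast hn i
  have := hx.2 i
  have := mul_pos ht.1 hi
  simp at *
  linarith

theorem lonelyRunnerZonotope_eq_union {d : ℕ} {n : Fin d → ℕ} (hn : ∀ i, 0 < n i) :
    lonelyRunnerZonotope n = Set.Icc 0 1 ∪ ⋃ i, sweptPart n i := by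
  have hn' : ∀ i, (0 : ℝ) < n i := fun i => by exact_mod_cast hn i
  ext x
  rw [mem_lonelyRunnerZonotope, Set.mem_union, Set.mem_iUnion]
  constructor
  · rintro ⟨t, ht, hx⟩
    refine or_iff_not_imp_left.2 fun hcube => ?_
    have h0 : ∀ i, 0 ≤ x i := fun i => (mul_nonneg ht.1 (hn' i).le).trans (hx i).1
    obtain ⟨k, hk⟩ : ∃ k, 1 < x k := by
      by_contra! h
      exact hcube ⟨h0, h⟩
    obtain ⟨m, -, hm⟩ := Finset.exists_max_image Finset.univ (fun i => (x i - 1) / n i)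
      ⟨k, Finset.mem_univ k⟩
    -- The first time at which the moving cube contains `x`; it is positive because `x` is outside
    -- the unit cube.
    set s := (x m - 1) / n m with hs
    have hxm : x m = s * n m + 1 := by
      rw [hs, div_mul_cancel₀ _ (hn' m).ne']; ring
    have hle : ∀ j, x j ≤ s * n j + 1 := fun j => by
      have := (div_le_iff₀ (hn' j)).1 (hm j (Finset.mem_univ j))
      linarith
    have hst : s ≤ t := by
      rw [hs, div_le_iff₀ (hn' m)]
      linarith [hx m]
    have hspos : 0 < s := lt_of_lt_of_le (div_pos (by linarith) (hn' k)) (hm k (Finset.mem_univ k))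
    obtain ⟨i, hi, hmin⟩ := Finset.exists_min_image
      (Finset.univ.filter fun i => x i = s * n i + 1) id ⟨m, by simpa using hxm⟩
    simp only [Finset.mem_filter, Finset.mem_univ, true_and, id] at hi hmin
    refine ⟨i, (mem_sweptPart hn i x).2 ⟨s, ⟨hspos, hst.trans ht.2⟩, hi, fun j => ⟨?_, hle j⟩,
      fun j hj => lt_of_le_of_ne (hle j) fun h => (hmin j h).not_gt hj⟩⟩
    exact (mul_le_mul_of_nonneg_right hst (hn' j).le).trans (hx j).1
  · rintro (hx | ⟨i, hi⟩)
    · exact ⟨0, by simp, fun i => by simpa using ⟨hx.1 i, hx.2 i⟩⟩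
    · obtain ⟨t, ht, -, hx, -⟩ := (mem_sweptPart hn i x).1 hi
      exact ⟨t, ⟨ht.1.le, ht.2⟩, hx⟩

theorem volume_lonelyRunnerZonotope {d : ℕ} {n : Fin d → ℕ} (hn : ∀ i, 0 < n i) :
    MeasureTheory.volume (lonelyRunnerZonotope n) = 1 + ∑ i, (n i : ℝ≥0∞) := by
  rw [lonelyRunnerZonotope_eq_union hn, MeasureTheory.measure_union
    (disjoint_Icc_iUnion_sweptPart hn) (MeasurableSet.iUnion fun i => measurableSet_sweptPart n i),
    MeasureTheory.measure_iUnion (pairwise_disjoint_sweptPart hn) (measurableSet_sweptPart n),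
    tsum_fintype, Real.volume_Icc_pi]
  simp [volume_sweptPart hn]

/-! ### Rational times and their denominators -/

/-- The times in `(0, 1]` at which one of the runners with speeds `n` is at an integer position. -/
def integralTimes {d : ℕ} (n : Fin d → ℕ) : Finset ℚ :=
  ((entryDivisors n).sigma fun ℓ => (Finset.Ico 1 (1 + ℓ)).filter ℓ.Coprime).image
    fun p => (p.2 : ℚ) / p.1

theorem mem_entryDivisors {d : ℕ} {n : Fin d → ℕ} (hn : ∀ i, 0 < n i) (ℓ : ℕ) :
    ℓ ∈ entryDivisors n ↔ ∃ i, ℓ ∣ n i := by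
  simp [entryDivisors, (hn _).ne']

theorem num_den_natCast_div {ℓ a : ℕ} (hℓ : 0 < ℓ) (hc : ℓ.Coprime a) :
    ((a : ℚ) / ℓ).num = a ∧ ((a : ℚ) / ℓ).den = ℓ := by
  have hℓ' : (0 : ℤ) < ℓ := by exact_mod_cast hℓ
  have h1 := Rat.num_div_eq_of_coprime (a := a) hℓ' (by simpa using hc.symm)
  have h2 := Rat.den_div_eq_of_coprime (a := a) hℓ' (by simpa using hc.symm)
  simp only [Int.cast_natCast] at h1 h2
  exact ⟨h1, Int.natCast_inj.1 h2⟩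

theorem mem_integralTimes {d : ℕ} {n : Fin d → ℕ} (hn : ∀ i, 0 < n i) (s : ℚ) :
    s ∈ integralTimes n ↔ 0 < s ∧ s ≤ 1 ∧ ∃ i, s.den ∣ n i := by
  simp only [integralTimes, Finset.mem_image, Finset.mem_sigma, mem_entryDivisors hn,
    Finset.mem_filter, Finset.mem_Ico, Sigma.exists]
  constructor
  · rintro ⟨ℓ, a, ⟨⟨i, hi⟩, ⟨ha1, ha2⟩, hc⟩, rfl⟩
    have hℓ : 0 < ℓ := Nat.pos_of_dvd_of_pos hi (hn i)
    have hℓ' : (0 : ℚ) < ℓ := by exact_mod_cast hℓ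
    refine ⟨div_pos (by exact_mod_cast ha1) hℓ', ?_, i, ?_⟩
    · rw [div_le_one hℓ']
      exact_mod_cast (by omega : a ≤ ℓ)
    · have h2 := (num_den_natCast_div hℓ hc).2
      rwa [h2]
  · rintro ⟨h0, h1, i, hi⟩
    have hnum : 0 < s.num := Rat.num_pos.2 h0
    have hle : s.num ≤ s.den := by
      rw [← Rat.num_div_den s, div_le_one (by exact_mod_cast s.den_pos)] at h1
      exact_mod_cast h1
    refine ⟨s.den, s.num.natAbs, ⟨⟨i, hi⟩, ⟨by omega, by omega⟩, s.reduced.symm⟩, ?_⟩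
    rw [Nat.cast_natAbs, abs_of_pos hnum]
    exact Rat.num_div_den s

/-- Reduced fractions are unique, so exactly `φ(ℓ)` times in `(0, 1]` have denominator `ℓ`. -/
theorem sum_integralTimes {d : ℕ} {n : Fin d → ℕ} (hn : ∀ i, 0 < n i) (f : ℕ → ℕ) :
    ∑ s ∈ integralTimes n, f s.den = ∑ ℓ ∈ entryDivisors n, ℓ.totient * f ℓ := by
  have hnd : ∀ p ∈ (entryDivisors n).sigma fun ℓ => (Finset.Ico 1 (1 + ℓ)).filter ℓ.Coprime,
      ((p.2 : ℚ) / p.1).den = p.1 ∧ ((p.2 : ℚ) / p.1).num = p.2 := by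
    rintro ⟨ℓ, a⟩ hp
    simp only [Finset.mem_sigma, mem_entryDivisors hn, Finset.mem_filter, Finset.mem_Ico] at hp
    obtain ⟨⟨i, hi⟩, -, hc⟩ := hp
    have hℓ : 0 < ℓ := Nat.pos_of_dvd_of_pos hi (hn i)
    exact (num_den_natCast_div hℓ hc).symm
  rw [integralTimes, Finset.sum_image, Finset.sum_sigma]
  · refine Finset.sum_congr rfl fun ℓ hℓ => ?_
    rw [Finset.sum_congr rfl fun a ha =>
      congrArg f (hnd ⟨ℓ, a⟩ (Finset.mem_sigma.2 ⟨hℓ, ha⟩)).1]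
    rw [← Nat.filter_coprime_Ico_eq_totient ℓ 1, ← smul_eq_mul, ← Finset.sum_const]
  · rintro ⟨ℓ, a⟩ hp ⟨m, b⟩ hq h
    simp only at h
    have h1 := hnd _ hp
    have h2 := hnd _ hq
    simp only [h] at h1
    obtain rfl : ℓ = m := h1.1.symm.trans h2.1
    obtain rfl : a = b := by exact_mod_cast h1.2.symm.trans h2.2
    rfl

theorem den_dvd_iff {s : ℚ} {m : ℕ} : s.den ∣ m ↔ ∃ z : ℤ, s * m = z := by
  have hd : (s.den : ℚ) ≠ 0 := by exact_mod_cast s.den_ne_zero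
  constructor
  · rintro ⟨k, rfl⟩
    refine ⟨s.num * k, ?_⟩
    push_cast
    rw [← mul_assoc, Rat.mul_den_eq_num]
  · rintro ⟨z, hz⟩
    have h : s.num * m = z * s.den := by
      have : (s.num : ℚ) * m = z * s.den := by
        rw [← Rat.mul_den_eq_num, ← hz]; ring
      exact_mod_cast this
    have h2 : (s.den : ℤ) ∣ s.num * m := ⟨z, by rw [h]; ring⟩
    have hc : IsCoprime (s.den : ℤ) s.num := by
      rw [Int.isCoprime_iff_gcd_eq_one]
      have := s.reduced
      rw [Int.gcd_comm]
      simpa [Int.gcd] using this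
    exact_mod_cast hc.dvd_of_dvd_mul_left h2

/-! ### Encoding lattice points by exit time and subset -/

/-- The least integer point above `s • n`, moved up by one in the coordinates in `S`. -/
def raisedCeil {d : ℕ} (n : Fin d → ℕ) (s : ℚ) (S : Finset (Fin d)) : Fin d → ℤ :=
  fun i => ⌈s * n i⌉ + if i ∈ S then 1 else 0

theorem le_raisedCeil {d : ℕ} (n : Fin d → ℕ) (s : ℚ) (S : Finset (Fin d)) (i : Fin d) :
    s * n i ≤ raisedCeil n s S i := by
  have := Int.le_ceil (s * n i)
  unfold raisedCeil
  split_ifs <;> push_cast <;> linarith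

theorem raisedCeil_eq {d : ℕ} {n : Fin d → ℕ} {s : ℚ} {i : Fin d} (h : s.den ∣ n i)
    (S : Finset (Fin d)) : (raisedCeil n s S i : ℚ) = s * n i + if i ∈ S then 1 else 0 := by
  obtain ⟨z, hz⟩ := den_dvd_iff.1 h
  rw [raisedCeil, hz, Int.ceil_intCast]
  split_ifs <;> simp

theorem exists_raisedCeil_eq {d : ℕ} {n : Fin d → ℕ} {s : ℚ} {S : Finset (Fin d)}
    (hS : S ⊂ divisibleIndices n s.den) : ∃ i, (raisedCeil n s S i : ℚ) = s * n i := by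
  obtain ⟨i, hi, hiS⟩ := Finset.exists_of_ssubset hS
  simp only [divisibleIndices, Finset.mem_filter, Finset.mem_univ, true_and] at hi
  exact ⟨i, by simp [raisedCeil_eq hi, hiS]⟩

/-- Properness of `S` leaves a coordinate equal to `s * n i`, so `s` is recovered as the minimum of
`z i / n i`. -/
theorem raisedCeil_inj {d : ℕ} {n : Fin d → ℕ} (hn : ∀ i, 0 < n i) {s t : ℚ}
    {S T : Finset (Fin d)} (hS : S ⊂ divisibleIndices n s.den)
    (hT : T ⊂ divisibleIndices n t.den) (h : raisedCeil n s S = raisedCeil n t T) :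
    s = t ∧ S = T := by
  have hn' : ∀ i, (0 : ℚ) < n i := fun i => by exact_mod_cast hn i
  obtain ⟨i, hi⟩ := exists_raisedCeil_eq hS
  obtain ⟨j, hj⟩ := exists_raisedCeil_eq hT
  obtain rfl : s = t := by
    apply le_antisymm
    · refine le_of_mul_le_mul_right ?_ (hn' j)
      rw [← hj, ← h]
      exact le_raisedCeil n s S j
    · refine le_of_mul_le_mul_right ?_ (hn' i)
      rw [← hi, h]
      exact le_raisedCeil n t T i
  refine ⟨rfl, ?_⟩
  ext k
  have hk := congrFun h k
  simp only [raisedCeil, add_right_inj] at hk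
  by_cases h1 : k ∈ S <;> by_cases h2 : k ∈ T <;> simp_all

/-- The subset `W ≠ univ` is sent to its indicator, and `univ` to the point `n + 1`. -/
def endpoint {d : ℕ} (n : Fin d → ℕ) (W : Finset (Fin d)) : Fin d → ℤ :=
  if W = Finset.univ then fun i => n i + 1 else fun i => if i ∈ W then 1 else 0

theorem endpoint_injective {d : ℕ} {n : Fin d → ℕ} (hd : 0 < d) (hn : ∀ i, 0 < n i) :
    Function.Injective (endpoint n) := by
  have key : ∀ W : Finset (Fin d),
      (fun i => (n i + 1 : ℤ)) ≠ fun i => if i ∈ W then (1 : ℤ) else 0 := by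
    intro W h
    have h0 := congrFun h ⟨0, hd⟩
    have := hn ⟨0, hd⟩
    split_ifs at h0 <;> omega
  intro V W h
  unfold endpoint at h
  split_ifs at h with hV hW hW
  · rw [hV, hW]
  · exact absurd h (key W)
  · exact absurd h.symm (key V)
  · ext k
    have hk := congrFun h k
    by_cases h1 : k ∈ V <;> by_cases h2 : k ∈ W <;> simp_all

/-- The exit time of an endpoint is `0` or greater than `1`, never in `(0, 1]`. -/
theorem endpoint_ne_raisedCeil {d : ℕ} {n : Fin d → ℕ} (hn : ∀ i, 0 < n i) {s : ℚ} (hs : 0 < s)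
    (hs1 : s ≤ 1) {S : Finset (Fin d)} (hS : S ⊂ divisibleIndices n s.den) (W : Finset (Fin d)) :
    endpoint n W ≠ raisedCeil n s S := by
  have hn' : ∀ i, (0 : ℚ) < n i := fun i => by exact_mod_cast hn i
  intro h
  by_cases hW : W = Finset.univ
  · obtain ⟨i, hi⟩ := exists_raisedCeil_eq hS
    rw [← h] at hi
    simp only [endpoint, if_pos hW] at hi
    push_cast at hi
    have := mul_le_mul_of_nonneg_right hs1 (hn' i).le
    linarith
  · obtain ⟨i, hi⟩ : ∃ i, i ∉ W := by
      by_contra! h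
      exact hW (Finset.eq_univ_iff_forall.2 h)
    have h1 := le_raisedCeil n s S i
    have := mul_pos hs (hn' i)
    rw [← h] at h1
    simp [endpoint, hW, hi] at h1
    linarith

theorem exists_minimal_ratio {d : ℕ} {n : Fin d → ℕ} (hd : 0 < d) (hn : ∀ i, 0 < n i)
    (z : Fin d → ℤ) : ∃ (s : ℚ) (i : Fin d), (z i : ℚ) = s * n i ∧ ∀ j, s * n j ≤ z j := by
  have hn' : ∀ i, (0 : ℚ) < n i := fun i => by exact_mod_cast hn i
  obtain ⟨i, -, hi⟩ := Finset.exists_min_image Finset.univ (fun i => (z i : ℚ) / n i)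
    ⟨⟨0, hd⟩, Finset.mem_univ _⟩
  exact ⟨z i / n i, i, (div_mul_cancel₀ _ (hn' i).ne').symm,
    fun j => (le_div_iff₀ (hn' j)).1 (hi j (Finset.mem_univ j))⟩

/-- Take for `S` the coordinates on upper facets at time `s`; it omits `i`, so it is proper. Off
`S`, `z j` lies in `[s * n j, s * n j + 1)` and is the ceiling. -/
theorem eq_raisedCeil {d : ℕ} {n : Fin d → ℕ} {z : Fin d → ℤ} {s : ℚ} {i : Fin d}
    (hi : (z i : ℚ) = s * n i) (hle : ∀ j, s * n j ≤ z j) (hge : ∀ j, (z j : ℚ) ≤ s * n j + 1) :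
    ∃ S ⊂ divisibleIndices n s.den, z = raisedCeil n s S := by
  refine ⟨Finset.univ.filter fun j => (z j : ℚ) = s * n j + 1, ?_, ?_⟩
  · refine (Finset.ssubset_iff_of_subset fun j hj => ?_).2 ⟨i, ?_, ?_⟩
    · simp only [Finset.mem_filter, Finset.mem_univ, true_and] at hj
      simp only [divisibleIndices, Finset.mem_filter, Finset.mem_univ, true_and]
      exact den_dvd_iff.2 ⟨z j - 1, by push_cast; linarith⟩
    · simp only [divisibleIndices, Finset.mem_filter, Finset.mem_univ, true_and]
      exact den_dvd_iff.2 ⟨z i, hi.symm⟩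
    · simp [hi]
  · ext j
    by_cases hj : (z j : ℚ) = s * n j + 1
    · have : s * n j = ((z j - 1 : ℤ) : ℚ) := by push_cast; linarith
      simp only [raisedCeil, Finset.mem_filter, Finset.mem_univ, true_and, hj, if_true]
      rw [this, Int.ceil_intCast]
      ring
    · simp only [raisedCeil, Finset.mem_filter, Finset.mem_univ, true_and, hj, if_false, add_zero]
      refine (Int.ceil_eq_iff.2 ⟨?_, hle j⟩).symm
      linarith [lt_of_le_of_ne (hge j) hj]

/-! ### Counting lattice points -/

theorem encard_inter_integerLattice {d : ℕ} (A : Set (Fin d → ℝ)) :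
    (A ∩ integerLattice d).encard =
      {z : Fin d → ℤ | (fun i => (z i : ℝ)) ∈ A}.encard := by
  rw [integerLattice, ← Set.image_preimage_eq_inter_range, Function.Injective.encard_image]
  · rfl
  · intro y z h
    ext i
    exact Int.cast_injective (α := ℝ) (congrFun h i)

theorem divisibleIndices_den_nonempty {d : ℕ} {n : Fin d → ℕ} (hn : ∀ i, 0 < n i) {s : ℚ}
    (hs : s ∈ integralTimes n) : (divisibleIndices n s.den).Nonempty := by
  obtain ⟨-, -, i, hi⟩ := (mem_integralTimes hn s).1 hs
  exact ⟨i, by simpa [divisibleIndices] using hi⟩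

theorem setOf_mem_interior_eq {d : ℕ} {n : Fin d → ℕ} (hd : 0 < d) (hn : ∀ i, 0 < n i) :
    {z : Fin d → ℤ | (fun i => (z i : ℝ)) ∈ interior (lonelyRunnerZonotope n)} =
      (integralTimes n).image fun s => raisedCeil n s ∅ := by
  have hnR : ∀ i, (0 : ℝ) < n i := fun i => by exact_mod_cast hn i
  have hnQ : ∀ i, (0 : ℚ) < n i := fun i => by exact_mod_cast hn i
  ext z
  simp only [Set.mem_ofPred_eq, mem_interior_lonelyRunnerZonotope, Finset.coe_image, Set.mem_image,
    Finset.mem_coe]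
  constructor
  · rintro ⟨t, ht, hz⟩
    obtain ⟨s, i, hi, hle⟩ := exists_minimal_ratio hd hn z
    have hi' : (z i : ℝ) = s * n i := by exact_mod_cast congrArg (Rat.cast : ℚ → ℝ) hi
    have hts : t < (s : ℝ) := by
      refine lt_of_mul_lt_mul_right ?_ (hnR i).le
      rw [← hi']
      exact (hz i).1
    have hlt : ∀ j, (z j : ℚ) < s * n j + 1 := fun j => by
      have : (z j : ℝ) < s * n j + 1 := by nlinarith [hz j, hnR j]
      exact_mod_cast this
    have hs0 : 0 < s := by exact_mod_cast ht.1.trans_lt hts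
    have hs1 : s ≤ 1 := by
      have h1 : (z i : ℝ) < n i + 1 := by nlinarith [hz i, hnR i, ht.2]
      have h2 : z i ≤ n i := Int.lt_add_one_iff.1 (by exact_mod_cast h1)
      refine le_of_mul_le_mul_right ?_ (hnQ i)
      rw [← hi, one_mul]
      exact_mod_cast h2
    refine ⟨s, (mem_integralTimes hn s).2 ⟨hs0, hs1, i, den_dvd_iff.2 ⟨z i, hi.symm⟩⟩, ?_⟩
    ext j
    simpa [raisedCeil] using Int.ceil_eq_iff.2 ⟨by linarith [hlt j], hle j⟩
  · rintro ⟨s, hs, rfl⟩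
    obtain ⟨hs0, hs1, -⟩ := (mem_integralTimes hn s).1 hs
    -- Just before its exit time the point is strictly inside the moving cube: stepping back by `δ`
    -- frees the lower facets, and a small `δ` keeps the upper ones strict.
    obtain ⟨δ, hδ, hδs, hδn⟩ : ∃ δ : ℚ, 0 < δ ∧ δ ≤ s ∧
        ∀ i, (raisedCeil n s ∅ i : ℚ) < (s - δ) * n i + 1 := by
      have hpos : ∀ i, 0 < (s * n i + 1 - raisedCeil n s ∅ i) / n i := fun i => by
        have := Int.ceil_lt_add_one (s * n i)
        refine div_pos ?_ (hnQ i)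
        simp only [raisedCeil, Finset.notMem_empty, if_false, add_zero]
        linarith
      obtain ⟨k, -, hk⟩ := Finset.exists_min_image Finset.univ
        (fun i => (s * n i + 1 - raisedCeil n s ∅ i) / n i) ⟨⟨0, hd⟩, Finset.mem_univ _⟩
      obtain ⟨δ, hδ0, hδ⟩ := exists_between (lt_min hs0 (hpos k))
      refine ⟨δ, hδ0, (hδ.trans_le (min_le_left _ _)).le, fun i => ?_⟩
      have := (lt_div_iff₀ (hnQ i)).1
        ((hδ.trans_le (min_le_right _ _)).trans_le (hk i (Finset.mem_univ i)))
      linarith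
    refine ⟨((s - δ : ℚ) : ℝ), ⟨?_, ?_⟩, fun i => ⟨?_, ?_⟩⟩
    · exact_mod_cast sub_nonneg.2 hδs
    · exact_mod_cast (by linarith : s - δ ≤ 1)
    · have h1 := le_raisedCeil n s ∅ i
      have h2 := mul_pos hδ (hnQ i)
      exact_mod_cast (by linarith : (s - δ) * n i < raisedCeil n s ∅ i)
    · exact_mod_cast hδn i

theorem setOf_mem_lonelyRunnerZonotope_eq {d : ℕ} {n : Fin d → ℕ} (hd : 0 < d)
    (hn : ∀ i, 0 < n i) :
    {z : Fin d → ℤ | (fun i => (z i : ℝ)) ∈ lonelyRunnerZonotope n} =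
      (Finset.univ.image (endpoint n) ∪
        ((integralTimes n).sigma fun s => (divisibleIndices n s.den).ssubsets).image
          fun p => raisedCeil n p.1 p.2 : Finset (Fin d → ℤ)) := by
  have hnR : ∀ i, (0 : ℝ) < n i := fun i => by exact_mod_cast hn i
  have hnQ : ∀ i, (0 : ℚ) < n i := fun i => by exact_mod_cast hn i
  ext z
  simp only [Set.mem_ofPred_eq, mem_lonelyRunnerZonotope, Finset.coe_union, Finset.coe_image,
    Set.mem_union, Set.mem_image, Finset.mem_coe, Finset.mem_sigma, Finset.mem_ssubsets,
    Sigma.exists, Finset.mem_univ, true_and]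
  constructor
  · rintro ⟨t, ht, hz⟩
    obtain ⟨s, i, hi, hle⟩ := exists_minimal_ratio hd hn z
    have hi' : (z i : ℝ) = s * n i := by exact_mod_cast congrArg (Rat.cast : ℚ → ℝ) hi
    have hts : t ≤ (s : ℝ) := by
      refine le_of_mul_le_mul_right ?_ (hnR i)
      rw [← hi']
      exact (hz i).1
    have hs0 : 0 ≤ s := by exact_mod_cast ht.1.trans hts
    rcases hs0.eq_or_lt with rfl | hs0
    · left
      have ht0 : t = 0 := le_antisymm (by exact_mod_cast hts) ht.1
      have hz01 : ∀ j, z j = 0 ∨ z j = 1 := fun j => by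
        have h1 := hz j
        rw [ht0, zero_mul, zero_add] at h1
        have h2 : 0 ≤ z j := by exact_mod_cast h1.1
        have h3 : z j ≤ 1 := by exact_mod_cast h1.2
        omega
      have hzi : z i = 0 := by
        rw [zero_mul] at hi
        exact_mod_cast hi
      refine ⟨Finset.univ.filter fun j => z j = 1, ?_⟩
      rw [endpoint, if_neg]
      · ext j
        rcases hz01 j with h | h <;> simp [h]
      · intro h
        have := Finset.eq_univ_iff_forall.1 h i
        simp [hzi] at this
    have hge : ∀ j, (z j : ℚ) ≤ s * n j + 1 := fun j => by
      have : (z j : ℝ) ≤ s * n j + 1 := by nlinarith [hz j, hnR j]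
      exact_mod_cast this
    rcases le_or_gt s 1 with hs1 | hs1
    · right
      obtain ⟨S, hS, rfl⟩ := eq_raisedCeil hi hle hge
      exact ⟨s, S, ⟨(mem_integralTimes hn s).2
        ⟨hs0, hs1, i, den_dvd_iff.2 ⟨_, hi.symm⟩⟩, hS⟩, rfl⟩
    -- If `s > 1`, then `n j < z j ≤ n j + 1` for every `j`, which leaves only `n + 1`.
    · left
      refine ⟨Finset.univ, ?_⟩
      rw [endpoint, if_pos rfl]
      ext j
      have h1 : (z j : ℝ) ≤ n j + 1 := by nlinarith [hz j, hnR j, ht.2]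
      have h2 : (n j : ℚ) < z j := by nlinarith [hle j, hnQ j]
      have h3 : z j ≤ n j + 1 := by exact_mod_cast h1
      have h4 : (n j : ℤ) < z j := by exact_mod_cast h2
      omega
  · rintro (⟨W, rfl⟩ | ⟨s, S, ⟨hs, hS⟩, rfl⟩)
    · by_cases hW : W = Finset.univ
      · exact ⟨1, by simp, fun i => by simp [endpoint, hW]⟩
      · refine ⟨0, by simp, fun i => ?_⟩
        simp only [endpoint, hW, if_false]
        split_ifs <;> simp
    · obtain ⟨hs0, hs1, -⟩ := (mem_integralTimes hn s).1 hs
      refine ⟨s, ⟨by exact_mod_cast hs0.le, by exact_mod_cast hs1⟩, fun i => ⟨?_, ?_⟩⟩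
      · exact_mod_cast le_raisedCeil n s S i
      · have : (raisedCeil n s S i : ℚ) ≤ s * n i + 1 := by
          by_cases hi : i ∈ S
          · have hd := hS.1 hi
            simp only [divisibleIndices, Finset.mem_filter, Finset.mem_univ, true_and] at hd
            rw [raisedCeil_eq hd, if_pos hi]
          · simpa [raisedCeil, hi] using (Int.ceil_lt_add_one (s * n i)).le
        exact_mod_cast this

theorem card_interior_lattice_points {d : ℕ} {n : Fin d → ℕ} (hd : 0 < d) (hn : ∀ i, 0 < n i) :
    (interior (lonelyRunnerZonotope n) ∩ integerLattice d).encard =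
      ((∑ ℓ ∈ entryDivisors n, Nat.totient ℓ : ℕ) : ℕ∞) := by
  rw [encard_inter_integerLattice, setOf_mem_interior_eq hd hn, Set.encard_coe_eq_coe_finsetCard,
    Finset.card_image_of_injOn, Finset.card_eq_sum_ones, sum_integralTimes hn fun _ => 1]
  · simp
  · intro s hs t ht h
    have hS := (divisibleIndices_den_nonempty hn hs).empty_ssubset
    have hT := (divisibleIndices_den_nonempty hn ht).empty_ssubset
    exact (raisedCeil_inj hn hS hT h).1

theorem card_lattice_points {d : ℕ} {n : Fin d → ℕ} (hd : 0 < d) (hn : ∀ i, 0 < n i) :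
    (lonelyRunnerZonotope n ∩ integerLattice d).encard =
      ((2 ^ d + ∑ ℓ ∈ entryDivisors n,
        Nat.totient ℓ * (2 ^ (divisibleIndices n ℓ).card - 1) : ℕ) : ℕ∞) := by
  rw [encard_inter_integerLattice, setOf_mem_lonelyRunnerZonotope_eq hd hn,
    Set.encard_coe_eq_coe_finsetCard, Finset.card_union_of_disjoint,
    Finset.card_image_of_injective _ (endpoint_injective hd hn), Finset.card_image_of_injOn,
    Finset.card_sigma]
  · simp only [Finset.ssubsets, Finset.card_erase_of_mem (Finset.mem_powerset_self _),
      Finset.card_powerset]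
    rw [sum_integralTimes hn fun ℓ => 2 ^ (divisibleIndices n ℓ).card - 1]
    simp
  · rintro ⟨s, S⟩ hs ⟨t, T⟩ ht h
    simp only [Finset.mem_coe, Finset.mem_sigma, Finset.mem_ssubsets] at hs ht
    obtain ⟨rfl, rfl⟩ := raisedCeil_inj hn hs.2 ht.2 h
    rfl
  · rw [Finset.disjoint_left]
    intro z hz hz'
    simp only [Finset.mem_image, Finset.mem_univ, true_and, Finset.mem_sigma,
      Finset.mem_ssubsets, Sigma.exists] at hz hz'
    obtain ⟨W, rfl⟩ := hz
    obtain ⟨s, S, ⟨hs, hS⟩, h⟩ := hz'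
    obtain ⟨hs0, hs1, -⟩ := (mem_integralTimes hn s).1 hs
    exact endpoint_ne_raisedCeil hn hs0 hs1 hS W h.symm

theorem theorem7p2 {d : ℕ} (n : Fin d → ℕ) (hn : IsVelocityVector n) :
    MeasureTheory.volume (lonelyRunnerZonotope n) = 1 + ∑ i, (n i : ℝ≥0∞) ∧
    (interior (lonelyRunnerZonotope n) ∩ integerLattice d).encard =
      ((∑ ℓ ∈ entryDivisors n, Nat.totient ℓ : ℕ) : ℕ∞) ∧
    (lonelyRunnerZonotope n ∩ integerLattice d).encard =
      ((2 ^ d + ∑ ℓ ∈ entryDivisors n,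
        Nat.totient ℓ * (2 ^ (divisibleIndices n ℓ).card - 1) : ℕ) : ℕ∞) := by
  have hd : 0 < d := zero_lt_two.trans_le hn.two_le
  exact ⟨volume_lonelyRunnerZonotope hn.pos, card_interior_lattice_points hd hn.pos,
    card_lattice_points hd hn.pos⟩
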